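/- Let $\mathbb{H}\cong\mathbb{R}^4$ be the quaternions with the Euclidean norm and let $\mathbb{S}=\{I\in\mathbb{H}: I^2=-1\}$. Each $I\in\mathbb{S}$ defines a constant orthogonal complex structure $v\mapsto Iv$ on $\mathbb{H}$. For a nonempty open set $D\subseteq\mathbb{H}$, a function $u:D\to[-\infty,+\infty)$ is called strongly subharmonic on $D$, written $u\in\mathsf{ssh}(D)$, if it is upper semicontinuous, not identically $-\infty$ on any connected component of $D$, and plurisubharmonic with respect to every constant structure $I\in\mathbb{S}$; the last condition means that, for all $I\in\mathbb{S}$, $a\in D$, $b\in\mathbb{H}$, the function $x+iy\mapsto u(a+(x+Iy)b)$ is, on each connected component of the open set $\{x+iy\in\mathbb{C}: a+(x+Iy)b\in D\}$, either subharmonic or identically $-\infty$. Let $\chi(q)=c\,\exp\left(-\frac{1}{1-|q|^2}\right)$ for $|q|<1$ and $\chi(q)=0$ for $|q|\ge 1$, where $c>0$ is such that $\int_{\mathbb{H}}\chi=1$; for $\varepsilon>0$ let $\chi_\varepsilon(q)=\varepsilon^{-4}\chi(q/\varepsilon)$. Let $\Omega\subseteq\mathbb{H}$ be a domain (a nonempty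 connected open set), and for $\varepsilon>0$ let $\Omega_\varepsilon=\{q\in\Omega:\mathrm{dist}(q,\partial\Omega)>\varepsilon\}$ if $\Omega\ne\mathbb{H}$, and $\Omega_\varepsilon=\mathbb{H}$ if $\Omega=\mathbb{H}$. For $u\in\mathsf{ssh}(\Omega)$ and $q\in\Omega_\varepsilon$ let $(u*\chi_\varepsilon)(q)=\int u(p)\,\chi_\varepsilon(q-p)\,dp$, the integral being taken over $\{p:|p-q|<\varepsilon\}\subseteq\Omega$. **Proposition.** Let $u\in\mathsf{ssh}(\Omega)$. 1. If $\varepsilon>0$ is such that $\Omega_\varepsilon\ne\emptyset$, then $u*\chi_\varepsilon$ is finite at every point of $\Omega_\varepsilon$ and $u*\chi_\varepsilon\in C^\infty(\Omega_\varepsilon)\cap\mathsf{ssh}(\Omega_\varepsilon)$. 2. If $0<\varepsilon_1\le\varepsilon_2$, then $u*\chi_{\varepsilon_1}\le u*\chi_{\varepsilon_2}$ on $\Omega_{\varepsilon_2}$. 3. For every $q\in\Omega$, $\lim_{\varepsilon\to0^+}(u*\chi_\varepsilon)(q)=u(q)$ in $[-\infty,+\infty)$. -/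

import Mathlib

open MeasureTheory Set Filter Topology
open scoped Quaternion ContDiff

/-- The quaternions carry their Borel sigma-algebra. Together with the Euclidean inner product this
makes `volume` on `ℍ[ℝ]` the four-dimensional Lebesgue measure. -/
noncomputable instance quaternionMeasurableSpace : MeasurableSpace ℍ[ℝ] := borel ℍ[ℝ]

instance quaternionBorelSpace : BorelSpace ℍ[ℝ] := ⟨rfl⟩

/-- The Lebesgue integral of a function with values in `[-∞, +∞]`: integral of the positive part
minus integral of the negative part. It is the usual integral with values in `[-∞, +∞)` when `f` is
measurable with integrable positive part; this is the case wherever it is used below, where `f` is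
upper semicontinuous (hence bounded above) on a compact set outside which it does not count. -/
noncomputable def erealIntegral {α : Type*} [MeasurableSpace α] (μ : Measure α) (f : α → EReal) :
    EReal :=
  ((∫⁻ x, (f x).toENNReal ∂μ : ENNReal) : EReal) - ((∫⁻ x, (-f x).toENNReal ∂μ : ENNReal) : EReal)

/-- The mean value of `v` over the circle with centre `z` and radius `r`. -/
noncomputable def circleMean (v : ℂ → EReal) (z : ℂ) (r : ℝ) : EReal :=
  (((2 * Real.pi)⁻¹ : ℝ) : EReal) *
    erealIntegral (volume.restrict (Ioc 0 (2 * Real.pi))) (fun θ : ℝ => v (circleMap z r θ))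

/-- `v` is upper semicontinuous on `U` with values in `[-∞, +∞)`. -/
def IsUSCOn {X : Type*} [TopologicalSpace X] (v : X → EReal) (U : Set X) : Prop :=
  UpperSemicontinuousOn v U ∧ ∀ x ∈ U, v x < ⊤

/-- `v` is, on every connected component of the open set `U ⊆ ℂ`, either subharmonic or identically
`-∞`: it is upper semicontinuous with values in `[-∞, +∞)` and satisfies the sub-mean value
inequality on every closed disc contained in `U`. -/
def IsSubharmonicOrBotOn (v : ℂ → EReal) (U : Set ℂ) : Prop :=
  IsUSCOn v U ∧ ∀ z : ℂ, ∀ r : ℝ, 0 < r → Metric.closedBall z r ⊆ U → v z ≤ circleMean v z r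

/-- The sphere of quaternionic imaginary units. -/
def imaginaryUnits : Set ℍ[ℝ] := {I | I * I = -1}

/-- The point `a + (x + I y) b` for `z = x + i y`. For `b ≠ 0`, the map `z ↦ complexLine I a b z`
parametrizes the complex line through `a` in the direction `b`, with respect to the constant complex
structure `v ↦ I v`. -/
noncomputable def complexLine (I a b : ℍ[ℝ]) (z : ℂ) : ℍ[ℝ] :=
  a + ((z.re : ℍ[ℝ]) + I * (z.im : ℍ[ℝ])) * b

/-- `us(Ω)`: the upper semicontinuous functions `Ω → [-∞, +∞)` that are not identically `-∞` (on any
connected component of `Ω`; when `Ω` is a domain this is just `u ≢ -∞`). Only the values of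
`u` on `Ω` matter. -/
def MemUS (u : ℍ[ℝ] → EReal) (Ω : Set ℍ[ℝ]) : Prop :=
  IsUSCOn u Ω ∧ ∀ q ∈ Ω, ∃ p ∈ connectedComponentIn Ω q, u p ≠ ⊥

/-- `u` is plurisubharmonic on `Ω` with respect to the constant orthogonal complex structure
`v ↦ I v`: it belongs to `us(Ω)` and its restriction to every complex line is, on every connected
component, subharmonic or identically `-∞`. -/
def IsPlurisubharmonicOn (I : ℍ[ℝ]) (u : ℍ[ℝ] → EReal) (Ω : Set ℍ[ℝ]) : Prop :=
  MemUS u Ω ∧ ∀ a ∈ Ω, ∀ b : ℍ[ℝ],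
    IsSubharmonicOrBotOn (fun z => u (complexLine I a b z)) (complexLine I a b ⁻¹' Ω)

/-- `ssh(Ω)`: `u` is strongly subharmonic on `Ω`, that is, plurisubharmonic with respect to every
constant orthogonal complex structure. -/
def IsStronglySubharmonicOn (u : ℍ[ℝ] → EReal) (Ω : Set ℍ[ℝ]) : Prop :=
  ∀ I ∈ imaginaryUnits, IsPlurisubharmonicOn I u Ω

/-- The standard smoothing kernel `χ` of `ℍ ≅ ℝ⁴`: the function `exp (-1 / (1 - |q|²))` on the open
unit ball, extended by `0`, divided by its integral. -/
noncomputable def standardKernel (q : ℍ[ℝ]) : ℝ :=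
  expNegInvGlue (1 - ‖q‖ ^ 2) / ∫ p : ℍ[ℝ], expNegInvGlue (1 - ‖p‖ ^ 2)

/-- `χ_ε (q) = ε⁻⁴ χ (q / ε)`. -/
noncomputable def scaledKernel (ε : ℝ) (q : ℍ[ℝ]) : ℝ :=
  (ε ^ 4)⁻¹ * standardKernel (ε⁻¹ • q)

/-- The convolution `(u * χ_ε)(q) = ∫ u(p) χ_ε(q - p) dp`, as an element of `[-∞, +∞]`. Points `p`
with `|q - p| ≥ ε` contribute `0`, whatever `u p` is. -/
noncomputable def mollify (u : ℍ[ℝ] → EReal) (ε : ℝ) (q : ℍ[ℝ]) : EReal :=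
  erealIntegral volume (fun p => u p * (scaledKernel ε (q - p) : EReal))

/-- `Ω_ε`: the points of `Ω` at distance more than `ε` from the boundary of `Ω`, and the whole space
if `Ω` is the whole space. -/
def innerDomain (Ω : Set ℍ[ℝ]) (ε : ℝ) : Set ℍ[ℝ] :=
  {q ∈ Ω | Ω ≠ univ → ε < Metric.infDist q (frontier Ω)}

/-! On a compact part of `Ω` the function u is bounded above by a real M, so M - u takes values in
[0, ∞] (`deficit`). Then u * χ_ε at q is M minus the average of `deficit` at q + εp, where p follows
the probability measure with density χ (`mollify_eq_coe_sub`). All estimates become Tonelli and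
Fatou arguments for nonnegative functions, and the value -∞ needs no separate treatment.

The key is to let a complex scalar replace the radius ε. Fix I and let m(z) be the average of M - u
at q + zp, where z = x + iy acts on p as left multiplication by x + Iy. For each p this runs along a
complex line, so m inherits the super-mean value inequality. It is lower semicontinuous by Fatou,
and it is radial because left multiplication by a unit quaternion preserves χ and Lebesgue measure.
A radial superharmonic function on a disc is smallest on the boundary circle
(`radial_le_of_superharmonic`), so m decreases with |z|. This is the monotonicity in ε
(`lintegral_deficit_antitone`); comparison with z = 0 gives u ≤ u * χ_ε, and upper semicontinuity
then gives the limit.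

The same comparison shows that u is integrable near every point where it is finite; connectedness
spreads this over `Ω` (`finiteAtFilter_withDensity_deficit`). Hence u * χ_ε is finite and smooth,
and as an average of translates of u it stays plurisubharmonic for every I. -/

/-! ### Extended-real arithmetic and circle means of M - w -/

theorem coe_sub_coe_ennreal_le_iff (M : ℝ) (x y : ENNReal) :
    (M : EReal) - x ≤ (M : EReal) - y ↔ y ≤ x := by
  induction x with
  | top => simp
  | coe x =>
    induction y with
    | top =>
      rw [EReal.coe_nnreal_eq_coe_real, ← EReal.coe_sub]
      simp only [EReal.coe_ennreal_top, EReal.sub_top, le_bot_iff, EReal.coe_ne_bot, top_le_iff,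
        ENNReal.coe_ne_top]
    | coe y =>
      simp only [EReal.coe_nnreal_eq_coe_real, ← EReal.coe_sub, EReal.coe_le_coe_iff,
        ENNReal.coe_le_coe, sub_le_sub_iff_left, NNReal.coe_le_coe]

theorem coe_sub_toENNReal {M : ℝ} {f : EReal} (h : f ≤ M) :
    (M : EReal) - ((M : EReal) - f).toENNReal = f := by
  have h0 : (0 : EReal) ≤ M - f := by
    induction f with
    | bot => simp
    | top => simp at h
    | coe f =>
      rw [← EReal.coe_sub]
      exact_mod_cast sub_nonneg.2 (EReal.coe_le_coe_iff.1 h)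
  rw [EReal.coe_toENNReal h0]
  induction f with
  | bot => simp
  | top => simp at h
  | coe f => norm_cast; ring

/-- The decomposition of M - w and M into positive and negative parts, with every subtracted term
moved across so that it remains meaningful for w = ∞ and can be integrated term by term. -/
theorem coe_sub_pos_part_add (M : ℝ) (w : ENNReal) :
    w + ((M : EReal) - w).toENNReal + ENNReal.ofReal (-M)
      = ENNReal.ofReal M + (-((M : EReal) - w)).toENNReal := by
  induction w with
  | top => simp
  | coe w =>
    simp only [EReal.coe_nnreal_eq_coe_real, ← EReal.coe_sub, ← EReal.coe_neg,
      EReal.real_coe_toENNReal]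
    rw [← ENNReal.ofReal_coe_nnreal]
    have hw : (0 : ℝ) ≤ w := w.2
    generalize (w : ℝ) = x at *
    have h1 : ∀ t : ℝ, ENNReal.ofReal t = ENNReal.ofReal (max t 0) := by
      intro t; simp
    rw [h1 (M - x), h1 (-M), h1 M, h1 (-(M - x)), ← ENNReal.ofReal_add hw (by simp),
      ← ENNReal.ofReal_add (by positivity) (by simp), ← ENNReal.ofReal_add (by simp) (by simp)]
    congr 1
    have h2 := max_zero_sub_max_neg_zero_eq_self M
    have h3 := max_zero_sub_max_neg_zero_eq_self (M - x)
    linarith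

/-- The integral of `M - w` is the integral of `M` minus the integral of `w`. -/
theorem erealIntegral_coe_sub {α : Type*} [MeasurableSpace α] (μ : Measure α) [IsFiniteMeasure μ]
    (M : ℝ) {w : α → ENNReal} (hw : AEMeasurable w μ) :
    erealIntegral μ (fun x => (M : EReal) - w x)
      = ((M * μ.real univ : ℝ) : EReal) - ((∫⁻ x, w x ∂μ : ENNReal) : EReal) := by
  unfold erealIntegral
  have hm : AEMeasurable (fun x => (M : EReal) - w x) μ := by
    simp_rw [sub_eq_add_neg]
    exact aemeasurable_const.add (hw.coe_ereal_ennreal.neg)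
  have key : ∫⁻ x, (w x + ((M : EReal) - w x).toENNReal + ENNReal.ofReal (-M)) ∂μ
      = ∫⁻ x, (ENNReal.ofReal M + (-((M : EReal) - w x)).toENNReal) ∂μ :=
    lintegral_congr fun x => coe_sub_pos_part_add M (w x)
  rw [lintegral_add_right _ measurable_const, lintegral_add_left' hw,
    lintegral_add_left measurable_const, lintegral_const, lintegral_const] at key
  have hP : ∫⁻ x, ((M : EReal) - w x).toENNReal ∂μ ≠ ⊤ := by
    refine ne_top_of_le_ne_top (b := ENNReal.ofReal M * μ univ) (by finiteness) ?_
    rw [← lintegral_const]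
    refine lintegral_mono fun x => ?_
    rw [← EReal.real_coe_toENNReal]
    refine EReal.toENNReal_le_toENNReal ?_
    have := (coe_sub_coe_ennreal_le_iff M (w x) 0).2 zero_le
    simpa using this
  generalize ∫⁻ x, ((M : EReal) - w x).toENNReal ∂μ = P at *
  generalize ∫⁻ x, (-((M : EReal) - w x)).toENNReal ∂μ = N at *
  generalize ∫⁻ x, w x ∂μ = W at *
  have hu : μ univ = ENNReal.ofReal (μ.real univ) := by simp
  have hmu : 0 ≤ μ.real univ := measureReal_nonneg
  rw [hu] at key
  generalize μ.real univ = m at *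
  lift P to NNReal using hP
  -- All other terms of `key` are finite, so W and N are infinite together.
  by_cases hN : N = ⊤
  · have : W = ⊤ := by
      by_contra hW
      rw [hN] at key
      simp only [add_top] at key
      exact (by finiteness : W + P + ENNReal.ofReal (-M) * ENNReal.ofReal m ≠ ⊤) key
    rw [hN, this]; simp
  · have hW : W ≠ ⊤ := by
      rintro rfl
      simp only [top_add] at key
      exact (by finiteness : ENNReal.ofReal M * ENNReal.ofReal m + N ≠ ⊤) key.symm
    lift N to NNReal using hN
    lift W to NNReal using hW
    have := congrArg ENNReal.toReal key
    rw [ENNReal.toReal_add (by finiteness) (by finiteness),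
      ENNReal.toReal_add (by finiteness) (by finiteness),
      ENNReal.toReal_add (by finiteness) (by finiteness)] at this
    simp only [ENNReal.coe_toReal, ENNReal.toReal_mul, ENNReal.toReal_ofReal',
      max_eq_left hmu] at this
    simp only [EReal.coe_nnreal_eq_coe_real, ← EReal.coe_sub, EReal.coe_eq_coe_iff]
    have h2 := max_zero_sub_max_neg_zero_eq_self M
    have h3 : M * m = max M 0 * m - max (-M) 0 * m := by rw [← sub_mul, h2]
    linarith

theorem circleMean_coe_sub (M : ℝ) {v : ℂ → EReal} {z : ℂ} {r : ℝ} {w : ℝ → ENNReal}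
    (hw : Measurable w) (hv : ∀ θ, v (circleMap z r θ) = (M : EReal) - w θ) :
    circleMean v z r = (M : EReal)
      - ((ENNReal.ofReal (2 * Real.pi)⁻¹ * ∫⁻ θ in Ioc 0 (2 * Real.pi), w θ : ENNReal) : EReal) := by
  unfold circleMean
  simp_rw [hv]
  rw [erealIntegral_coe_sub _ M hw.aemeasurable]
  have hpi : 0 < 2 * Real.pi := Real.two_pi_pos
  have : (volume.restrict (Ioc 0 (2 * Real.pi))).real univ = 2 * Real.pi := by
    simp [Real.pi_pos.le]
  rw [this]
  generalize ∫⁻ θ in Ioc 0 (2 * Real.pi), w θ = W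
  generalize 2 * Real.pi = c at *
  by_cases hW : W = ⊤
  · subst hW
    rw [ENNReal.mul_top (by simpa using hpi)]
    simp only [EReal.coe_ennreal_top, EReal.sub_top]
    exact EReal.coe_mul_bot_of_pos (inv_pos.2 hpi)
  · lift W to NNReal using hW
    rw [← ENNReal.ofReal_coe_nnreal, ← ENNReal.ofReal_mul (by positivity)]
    rw [EReal.coe_ennreal_ofReal, EReal.coe_ennreal_ofReal, max_eq_left (by positivity),
      max_eq_left (by positivity)]
    norm_cast
    field_simp

theorem IsSubharmonicOrBotOn.lintegral_circle_le {v : ℂ → EReal} {U : Set ℂ}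
    (h : IsSubharmonicOrBotOn v U) {M : ℝ} {z : ℂ} {r : ℝ} {w : ℂ → ENNReal} (hr : 0 < r)
    (hU : Metric.closedBall z r ⊆ U) (hw : Measurable fun θ => w (circleMap z r θ))
    (hv : ∀ x ∈ Metric.closedBall z r, v x = (M : EReal) - w x) :
    ENNReal.ofReal (2 * Real.pi)⁻¹ * ∫⁻ θ in Ioc 0 (2 * Real.pi), w (circleMap z r θ) ≤ w z := by
  have := h.2 z r hr hU
  rwa [circleMean_coe_sub M hw fun θ => hv _ (circleMap_mem_closedBall z hr.le θ),
    hv z (Metric.mem_closedBall_self hr.le), coe_sub_coe_ennreal_le_iff] at this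

/-! ### Imaginary units and complex lines -/

theorem norm_eq_one_of_mem_imaginaryUnits {I : ℍ[ℝ]} (hI : I ∈ imaginaryUnits) : ‖I‖ = 1 := by
  have h : ‖I * I‖ = ‖(-1 : ℍ[ℝ])‖ := congrArg norm hI
  rw [norm_mul, norm_neg, norm_one] at h
  nlinarith [norm_nonneg I]

theorem re_eq_zero_of_mem_imaginaryUnits {I : ℍ[ℝ]} (hI : I ∈ imaginaryUnits) : I.re = 0 := by
  have h : I * I = -1 := hI
  have h0 := congrArg QuaternionAlgebra.re h
  have h1 := congrArg QuaternionAlgebra.imI h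
  have h2 := congrArg QuaternionAlgebra.imJ h
  have h3 := congrArg QuaternionAlgebra.imK h
  simp at h0 h1 h2 h3
  by_contra hre
  have e1 : I.imI = 0 := by
    have : I.re * I.imI = 0 := by linarith
    simpa [hre] using this
  have e2 : I.imJ = 0 := by
    have : I.re * I.imJ = 0 := by linarith
    simpa [hre] using this
  have e3 : I.imK = 0 := by
    have : I.re * I.imK = 0 := by linarith
    simpa [hre] using this
  rw [e1, e2, e3] at h0
  nlinarith [mul_self_nonneg I.re]

/-- The embedding `x + i y ↦ x + I y` of the complex numbers into the quaternions. -/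
noncomputable def complexEmbedding {I : ℍ[ℝ]} (hI : I ∈ imaginaryUnits) : ℂ →ₐ[ℝ] ℍ[ℝ] :=
  Complex.lift ⟨I, hI⟩

theorem complexLine_eq {I : ℍ[ℝ]} (hI : I ∈ imaginaryUnits) (a b : ℍ[ℝ]) (z : ℂ) :
    complexLine I a b z = a + complexEmbedding hI z * b := by
  simp only [complexLine, complexEmbedding, Complex.lift_apply, Complex.liftAux_apply]
  congr 2
  rw [Algebra.smul_def, Algebra.commutes]
  rfl

theorem norm_complexEmbedding {I : ℍ[ℝ]} (hI : I ∈ imaginaryUnits) (z : ℂ) :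
    ‖complexEmbedding hI z‖ = ‖z‖ := by
  have h1 := norm_eq_one_of_mem_imaginaryUnits hI
  have h0 := re_eq_zero_of_mem_imaginaryUnits hI
  rw [← sq_eq_sq₀ (norm_nonneg _) (norm_nonneg _), Complex.sq_norm, Complex.normSq_apply, sq,
    ← Quaternion.normSq_eq_norm_mul_self]
  have h2 : Quaternion.normSq I = 1 := by rw [Quaternion.normSq_eq_norm_mul_self, h1, one_mul]
  rw [Quaternion.normSq_def'] at h2 ⊢
  simp [complexEmbedding, Complex.lift_apply, Complex.liftAux_apply, h0] at h2 ⊢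
  linear_combination z.im ^ 2 * h2

theorem continuous_complexLine (I : ℍ[ℝ]) :
    Continuous fun x : ℍ[ℝ] × ℍ[ℝ] × ℂ => complexLine I x.1 x.2.1 x.2.2 := by
  unfold complexLine
  have := Quaternion.continuous_coe
  fun_prop

/-! ### The smoothing kernel and its invariant probability measure -/

theorem standardKernel_nonneg (q : ℍ[ℝ]) : 0 ≤ standardKernel q :=
  div_nonneg (expNegInvGlue.nonneg _) (integral_nonneg fun _ => expNegInvGlue.nonneg _)

theorem contDiff_expNegInvGlue_norm : ContDiff ℝ ∞ fun q : ℍ[ℝ] => expNegInvGlue (1 - ‖q‖ ^ 2) :=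
  expNegInvGlue.contDiff.comp (contDiff_const.sub (contDiff_norm_sq ℝ))

theorem contDiff_standardKernel : ContDiff ℝ ∞ standardKernel :=
  contDiff_expNegInvGlue_norm.div_const _

theorem expNegInvGlue_norm_eq_zero {q : ℍ[ℝ]} (hq : 1 ≤ ‖q‖) : expNegInvGlue (1 - ‖q‖ ^ 2) = 0 :=
  expNegInvGlue.zero_of_nonpos (by nlinarith)

theorem standardKernel_eq_zero {q : ℍ[ℝ]} (hq : 1 ≤ ‖q‖) : standardKernel q = 0 := by
  rw [standardKernel, expNegInvGlue_norm_eq_zero hq, zero_div]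

theorem hasCompactSupport_expNegInvGlue_norm :
    HasCompactSupport fun q : ℍ[ℝ] => expNegInvGlue (1 - ‖q‖ ^ 2) :=
  HasCompactSupport.intro (isCompact_closedBall 0 1) fun q hq =>
    expNegInvGlue_norm_eq_zero (by simpa using (not_le.1 (by simpa using hq)).le)

theorem hasCompactSupport_standardKernel : HasCompactSupport standardKernel :=
  HasCompactSupport.intro (isCompact_closedBall 0 1) fun q hq =>
    standardKernel_eq_zero (by simpa using (not_le.1 (by simpa using hq)).le)

theorem integral_expNegInvGlue_norm_pos : 0 < ∫ p : ℍ[ℝ], expNegInvGlue (1 - ‖p‖ ^ 2) :=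
  contDiff_expNegInvGlue_norm.continuous.integral_pos_of_hasCompactSupport_nonneg_nonzero
    hasCompactSupport_expNegInvGlue_norm (fun _ => expNegInvGlue.nonneg _) (x := 0)
    (expNegInvGlue.pos_of_pos (by simp)).ne'

theorem standardKernel_pos {q : ℍ[ℝ]} (hq : ‖q‖ < 1) : 0 < standardKernel q :=
  div_pos (expNegInvGlue.pos_of_pos (by nlinarith [norm_nonneg q])) integral_expNegInvGlue_norm_pos

theorem standardKernel_congr {p q : ℍ[ℝ]} (h : ‖p‖ = ‖q‖) : standardKernel p = standardKernel q := by
  rw [standardKernel, standardKernel, h]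

theorem integral_standardKernel : ∫ q, standardKernel q = 1 := by
  unfold standardKernel
  rw [integral_div, div_self integral_expNegInvGlue_norm_pos.ne']

/-- The probability measure on the unit ball whose density is the standard kernel. -/
noncomputable def kernelMeasure : Measure ℍ[ℝ] :=
  volume.withDensity fun q => ENNReal.ofReal (standardKernel q)

theorem measurable_ofReal_standardKernel :
    Measurable fun q => ENNReal.ofReal (standardKernel q) :=
  contDiff_standardKernel.continuous.measurable.ennreal_ofReal

theorem lintegral_kernelMeasure (f : ℍ[ℝ] → ENNReal) :
    ∫⁻ q, f q ∂kernelMeasure = ∫⁻ q, ENNReal.ofReal (standardKernel q) * f q :=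
  lintegral_withDensity_eq_lintegral_mul_non_measurable _ measurable_ofReal_standardKernel
    (ae_of_all _ fun _ => ENNReal.ofReal_lt_top) f

instance isProbabilityMeasure_kernelMeasure : IsProbabilityMeasure kernelMeasure := by
  constructor
  rw [kernelMeasure, withDensity_apply _ MeasurableSet.univ, Measure.restrict_univ,
    ← ofReal_integral_eq_lintegral_ofReal
      (contDiff_standardKernel.continuous.integrable_of_hasCompactSupport
        hasCompactSupport_standardKernel) (ae_of_all _ standardKernel_nonneg),
    integral_standardKernel, ENNReal.ofReal_one]

theorem ae_kernelMeasure_norm_lt_one : ∀ᵐ p ∂kernelMeasure, ‖p‖ < 1 := by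
  rw [kernelMeasure, ae_withDensity_iff measurable_ofReal_standardKernel]
  refine ae_of_all _ fun p hp => ?_
  by_contra h
  exact hp (by simp [standardKernel_eq_zero (not_lt.1 h)])

/-- The quaternion norm is multiplicative, so left multiplication by c is a linear isometry and
preserves volume. -/
theorem lintegral_comp_unit_mul {c : ℍ[ℝ]} (hc : ‖c‖ = 1) (f : ℍ[ℝ] → ENNReal) :
    ∫⁻ p, f (c * p) = ∫⁻ p, f p := by
  have hc0 : c ≠ 0 := by rintro rfl; simp at hc
  let e : ℍ[ℝ] ≃ₗᵢ[ℝ] ℍ[ℝ] :=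
    { LinearEquiv.ofInjectiveEndo (LinearMap.mulLeft ℝ c) (mul_right_injective₀ hc0) with
      norm_map' := fun x => by
        change ‖c * x‖ = ‖x‖
        rw [norm_mul, hc, one_mul] }
  exact e.measurePreserving.lintegral_comp_emb e.toHomeomorph.measurableEmbedding f

theorem lintegral_kernelMeasure_comp_unit_mul {c : ℍ[ℝ]} (hc : ‖c‖ = 1) (f : ℍ[ℝ] → ENNReal) :
    ∫⁻ p, f (c * p) ∂kernelMeasure = ∫⁻ p, f p ∂kernelMeasure := by
  rw [lintegral_kernelMeasure, lintegral_kernelMeasure,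
    ← lintegral_comp_unit_mul hc fun p => ENNReal.ofReal (standardKernel p) * f p]
  refine lintegral_congr fun p => ?_
  rw [standardKernel_congr (p := c * p) (q := p) (by rw [norm_mul, hc, one_mul])]

/-- Change of variables p ↦ q + εp, whose Jacobian ε⁴ cancels the normalization of χ_ε. No
measurability of f is required, since u is arbitrary outside `Ω`. -/
theorem lintegral_scaledKernel_mul {ε : ℝ} (hε : 0 < ε) (q : ℍ[ℝ]) (f : ℍ[ℝ] → ENNReal) :
    ∫⁻ p, ENNReal.ofReal (scaledKernel ε (q - p)) * f p
      = ∫⁻ p, f (q + ε • p) ∂kernelMeasure := by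
  rw [lintegral_kernelMeasure]
  have h1 := (Homeomorph.smulOfNeZero (α := ℍ[ℝ]) ε hε.ne').measurableEmbedding.lintegral_map
    (μ := volume) fun p => ENNReal.ofReal (scaledKernel ε (q - (q + p))) * f (q + p)
  have h2 : Measure.map (Homeomorph.smulOfNeZero (α := ℍ[ℝ]) ε hε.ne') volume
      = ENNReal.ofReal |(ε ^ Module.finrank ℝ ℍ[ℝ])⁻¹| • (volume : Measure ℍ[ℝ]) :=
    Measure.map_addHaar_smul volume hε.ne'
  rw [h2, lintegral_smul_measure, Quaternion.finrank_eq_four, abs_of_pos (by positivity),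
    lintegral_add_left_eq_self fun p => ENNReal.ofReal (scaledKernel ε (q - p)) * f p] at h1
  have h4 : ENNReal.ofReal (ε ^ 4) * ENNReal.ofReal (ε ^ 4)⁻¹ = 1 := by
    rw [← ENNReal.ofReal_mul (by positivity), mul_inv_cancel₀ (by positivity), ENNReal.ofReal_one]
  rw [← one_mul (∫⁻ p, _ * f p), ← h4, mul_assoc, ← smul_eq_mul (ENNReal.ofReal (ε ^ 4)⁻¹), h1,
    ← lintegral_const_mul' _ _ ENNReal.ofReal_ne_top]
  refine lintegral_congr fun p => ?_
  rw [← mul_assoc, ← ENNReal.ofReal_mul (by positivity)]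
  change ENNReal.ofReal (ε ^ 4 * scaledKernel ε (q - (q + ε • p))) * f (q + ε • p) = _
  congr 2
  rw [scaledKernel, ← mul_assoc, mul_inv_cancel₀ (by positivity), one_mul]
  refine standardKernel_congr ?_
  rw [sub_add_cancel_left, smul_neg, inv_smul_smul₀ hε.ne', norm_neg]

theorem scaledKernel_nonneg {ε : ℝ} (hε : 0 < ε) (q : ℍ[ℝ]) : 0 ≤ scaledKernel ε q :=
  mul_nonneg (by positivity) (standardKernel_nonneg _)

theorem mollify_eq_erealIntegral {ε : ℝ} (hε : 0 < ε) (u : ℍ[ℝ] → EReal) (q : ℍ[ℝ]) :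
    mollify u ε q = erealIntegral kernelMeasure fun p => u (q + ε • p) := by
  have hk : ∀ p, (0 : EReal) ≤ scaledKernel ε (q - p) := fun p =>
    EReal.coe_nonneg.2 (scaledKernel_nonneg hε _)
  rw [mollify, erealIntegral, erealIntegral,
    ← lintegral_scaledKernel_mul hε q fun p => (u p).toENNReal,
    ← lintegral_scaledKernel_mul hε q fun p => (-u p).toENNReal]
  congr 3
  · funext p
    rw [mul_comm, EReal.toENNReal_mul (hk p), EReal.real_coe_toENNReal]
  · funext p
    rw [← EReal.neg_mul, mul_comm, EReal.toENNReal_mul (hk p), EReal.real_coe_toENNReal]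

theorem erealIntegral_congr_ae {α : Type*} [MeasurableSpace α] {μ : Measure α} {f g : α → EReal}
    (h : f =ᵐ[μ] g) : erealIntegral μ f = erealIntegral μ g := by
  have h1 : ∫⁻ x, (f x).toENNReal ∂μ = ∫⁻ x, (g x).toENNReal ∂μ :=
    lintegral_congr_ae (h.mono fun x hx => congrArg EReal.toENNReal hx)
  have h2 : ∫⁻ x, (-f x).toENNReal ∂μ = ∫⁻ x, (-g x).toENNReal ∂μ :=
    lintegral_congr_ae (h.mono fun x hx => congrArg (fun y => (-y).toENNReal) hx)
  rw [erealIntegral, erealIntegral, h1, h2]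

/-! ### The function M - u and its averages -/

open scoped Classical in
/-- The function `M - u` on `Ω`, with values in `[0, ∞]`, extended by `∞`. -/
noncomputable def deficit (u : ℍ[ℝ] → EReal) (Ω : Set ℍ[ℝ]) (M : ℝ) (p : ℍ[ℝ]) : ENNReal :=
  ((M : EReal) - if p ∈ Ω then u p else ⊥).toENNReal

section

variable {u : ℍ[ℝ] → EReal} {Ω : Set ℍ[ℝ]}

theorem coe_sub_deficit {M : ℝ} {p : ℍ[ℝ]} (hp : p ∈ Ω) (h : u p ≤ M) :
    (M : EReal) - deficit u Ω M p = u p := by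
  rw [deficit, if_pos hp, coe_sub_toENNReal h]

theorem measurable_deficit (hΩ : IsOpen Ω) (hu : IsUSCOn u Ω) (M : ℝ) :
    Measurable (deficit u Ω M) := by
  classical
  have : Measurable fun p => if p ∈ Ω then u p else ⊥ := by
    refine measurable_of_Iio fun c => ?_
    rcases eq_or_ne c ⊥ with rfl | hc
    · simp
    have h1 : IsOpen (Ω ∩ {p | u p < c}) := by
      rw [isOpen_iff_mem_nhds]
      intro p hp
      have := hu.1 p hp.1 c hp.2
      rw [hΩ.nhdsWithin_eq hp.1] at this
      exact Filter.inter_mem (hΩ.mem_nhds hp.1) this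
    convert h1.measurableSet.union hΩ.measurableSet.compl using 1
    ext p
    by_cases hp : p ∈ Ω <;> simp [hp, hc.bot_lt]
  unfold deficit
  simp_rw [sub_eq_add_neg]
  exact (measurable_const.add this.neg).ereal_toENNReal

theorem lowerSemicontinuousAt_deficit (hΩ : IsOpen Ω) (hu : IsUSCOn u Ω) (M : ℝ) {p : ℍ[ℝ]}
    (hp : p ∈ Ω) : LowerSemicontinuousAt (deficit u Ω M) p := by
  intro c hc
  rw [deficit, if_pos hp] at hc
  have hc' : (c : EReal) < (M : EReal) - u p := by
    have h0 : (0 : EReal) ≤ M - u p := by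
      by_contra h
      rw [EReal.toENNReal_of_nonpos (not_le.1 h).le] at hc
      simp at hc
    rw [← EReal.coe_toENNReal h0]
    exact EReal.coe_ennreal_lt_coe_ennreal_iff.2 hc
  have hct : c ≠ ⊤ := hc.ne_top
  lift c to NNReal using hct
  rw [EReal.coe_nnreal_eq_coe_real] at hc'
  have key : ∀ x : EReal, ((c : ℝ) : EReal) < (M : EReal) - x ↔ x < ((M - c : ℝ) : EReal) := by
    intro x
    induction x with
    | bot => simp only [EReal.coe_sub_bot, EReal.coe_lt_top, EReal.bot_lt_coe]
    | top => simp
    | coe x =>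
      rw [← EReal.coe_sub, EReal.coe_lt_coe_iff, EReal.coe_lt_coe_iff]
      constructor <;> intro h <;> linarith
  have h1 := hu.1 p hp _ ((key _).1 hc')
  rw [hΩ.nhdsWithin_eq hp] at h1
  filter_upwards [h1, hΩ.mem_nhds hp] with x hx hxΩ
  rw [deficit, if_pos hxΩ]
  have h2 := (key _).2 hx
  have h0 : (0 : EReal) ≤ M - u x := le_trans (by simp) h2.le
  rw [gt_iff_lt, ← EReal.coe_ennreal_lt_coe_ennreal_iff, EReal.coe_toENNReal h0]
  rwa [EReal.coe_nnreal_eq_coe_real]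

theorem exists_real_upper_bound (hu : IsUSCOn u Ω) {K : Set ℍ[ℝ]} (hK : IsCompact K)
    (hKΩ : K ⊆ Ω) : ∃ M : ℝ, 0 ≤ M ∧ ∀ p ∈ K, u p ≤ M := by
  rcases K.eq_empty_or_nonempty with rfl | hne
  · exact ⟨0, le_rfl, by simp⟩
  obtain ⟨a, ha, hmax⟩ := (hu.1.mono hKΩ).exists_isMaxOn hne hK
  refine ⟨max (u a).toReal 0, le_max_right _ _, fun p hp => (hmax hp).trans ?_⟩
  refine (EReal.le_coe_toReal (hu.2 a (hKΩ ha)).ne).trans ?_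
  exact_mod_cast le_max_left _ _

/-- `kernelMeasure` is carried by the open unit ball, so only values of u on the ball of radius ε
about q enter, and there u = M - `deficit`. -/
theorem mollify_eq_coe_sub (hΩ : IsOpen Ω) (hu : IsUSCOn u Ω) {ε : ℝ} (hε : 0 < ε) {q : ℍ[ℝ]}
    {M : ℝ} (hq : Metric.closedBall q ε ⊆ Ω) (hM : ∀ p ∈ Metric.closedBall q ε, u p ≤ M) :
    mollify u ε q
      = (M : EReal) - ((∫⁻ p, deficit u Ω M (q + ε • p) ∂kernelMeasure : ENNReal) : EReal) := by
  have hae : ∀ᵐ p ∂kernelMeasure, u (q + ε • p) = (M : EReal) - deficit u Ω M (q + ε • p) := by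
    filter_upwards [ae_kernelMeasure_norm_lt_one] with p hp
    have : q + ε • p ∈ Metric.closedBall q ε := by
      rw [mem_closedBall_iff_norm, add_sub_cancel_left, norm_smul, Real.norm_of_nonneg hε.le]
      nlinarith
    rw [coe_sub_deficit (hq this) (hM _ this)]
  have hm : Measurable fun p => deficit u Ω M (q + ε • p) :=
    (measurable_deficit hΩ hu M).comp (by fun_prop)
  have := erealIntegral_coe_sub kernelMeasure M hm.aemeasurable
  rw [probReal_univ, mul_one] at this
  rw [mollify_eq_erealIntegral hε, ← this, erealIntegral_congr_ae hae]

/-- Superharmonicity of an average of superharmonic functions on complex lines. -/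
theorem lintegral_circle_lintegral_deficit_le (hΩ : IsOpen Ω) {I : ℍ[ℝ]}
    (hu : IsPlurisubharmonicOn I u Ω) {α β : ℍ[ℝ] → ℍ[ℝ]} (hα : Continuous α) (hβ : Continuous β)
    {z : ℂ} {r M : ℝ} (hr : 0 < r) (hαΩ : ∀ p, ‖p‖ < 1 → α p ∈ Ω)
    (hΩp : ∀ p, ‖p‖ < 1 → ∀ x ∈ Metric.closedBall z r, complexLine I (α p) (β p) x ∈ Ω)
    (hM : ∀ p, ‖p‖ < 1 → ∀ x ∈ Metric.closedBall z r, u (complexLine I (α p) (β p) x) ≤ M) :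
    ENNReal.ofReal (2 * Real.pi)⁻¹ * ∫⁻ θ in Ioc 0 (2 * Real.pi),
        ∫⁻ p, deficit u Ω M (complexLine I (α p) (β p) (circleMap z r θ)) ∂kernelMeasure
      ≤ ∫⁻ p, deficit u Ω M (complexLine I (α p) (β p) z) ∂kernelMeasure := by
  have hcont : Continuous fun x : ℝ × ℍ[ℝ] =>
      complexLine I (α x.2) (β x.2) (circleMap z r x.1) :=
    (continuous_complexLine I).comp
      ((hα.comp continuous_snd).prodMk ((hβ.comp continuous_snd).prodMk
        ((continuous_circleMap z r).comp continuous_fst)))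
  have hmeas := (measurable_deficit hΩ hu.1.1 M).comp hcont.measurable
  rw [lintegral_lintegral_swap (f := fun θ p =>
    deficit u Ω M (complexLine I (α p) (β p) (circleMap z r θ))) hmeas.aemeasurable,
    ← lintegral_const_mul' _ _ ENNReal.ofReal_ne_top]
  refine lintegral_mono_ae ?_
  filter_upwards [ae_kernelMeasure_norm_lt_one] with p hp
  refine (hu.2 (α p) (hαΩ p hp) (β p)).lintegral_circle_le (M := M)
    (w := fun x => deficit u Ω M (complexLine I (α p) (β p) x)) hr (fun x hx => hΩp p hp x hx)
    (hmeas.comp (measurable_id.prodMk measurable_const)) fun x hx => ?_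
  rw [coe_sub_deficit (hΩp p hp x hx) (hM p hp x hx)]

end

/-! ### Radial superharmonic functions on a disc -/

/-- A radial superharmonic function on a disc centred at the origin is minimal on the boundary. -/
theorem radial_le_of_superharmonic {m : ℂ → ENNReal} {R : ℝ} (hm : Measurable m)
    (hlsc : LowerSemicontinuousOn m (Metric.closedBall 0 R)) (hrad : ∀ z, m z = m (‖z‖ : ℝ))
    (hmean : ∀ z s, 0 < s → Metric.closedBall z s ⊆ Metric.closedBall 0 R →
      ENNReal.ofReal (2 * Real.pi)⁻¹ * ∫⁻ θ in Ioc 0 (2 * Real.pi), m (circleMap z s θ) ≤ m z)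
    {r : ℝ} (hr : 0 ≤ r) (hrR : r ≤ R) : m R ≤ m r := by
  have hR : 0 ≤ R := hr.trans hrR
  obtain ⟨z₀, hz₀, hmin⟩ := hlsc.exists_isMinOn ⟨0, by simpa using hR⟩ (isCompact_closedBall 0 R)
  have hmin' : ∀ z : ℂ, ‖z‖ ≤ R → m z₀ ≤ m z := fun z hz => hmin (by simpa using hz)
  suffices h : m R = m z₀ by
    rw [h]
    exact hmin' _ (by simpa [abs_of_nonneg hr] using hrR)
  by_contra hne
  have hlt : m z₀ < m R := lt_of_le_of_ne (hmin' _ (by simp [abs_of_nonneg hR])) (Ne.symm hne)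
  have hfin : m z₀ ≠ ⊤ := hlt.ne_top
  -- the largest modulus of a minimum point
  have hclosed : IsCompact (Metric.closedBall 0 R ∩ m ⁻¹' Iic (m z₀)) := by
    obtain ⟨v, hv, hveq⟩ := lowerSemicontinuousOn_iff_preimage_Iic.1 hlsc (m z₀)
    rw [hveq]
    exact (isCompact_closedBall 0 R).inter_right hv
  obtain ⟨z₁, ⟨hz₁, hz₁m⟩, hmax⟩ := hclosed.exists_isMaxOn ⟨z₀, hz₀, le_refl (m z₀)⟩
    continuous_norm.continuousOn
  have hz₁m' : m z₁ ≤ m z₀ := hz₁m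
  have hz₁R : ‖z₁‖ < R := by
    refine lt_of_le_of_ne (by simpa using hz₁) fun h => ?_
    rw [hrad, h] at hz₁m'
    exact hlt.not_ge hz₁m'
  -- By radial symmetry the real point ρ is also a minimum point. The mean value inequality is
  -- tested on the disc about ρ of radius R - ρ, which just fits into the large disc.
  set ρ := ‖z₁‖ with hρ
  have hρ0 : 0 ≤ ρ := norm_nonneg _
  have hs : 0 < R - ρ := sub_pos.2 hz₁R
  have hsub : Metric.closedBall (ρ : ℂ) (R - ρ) ⊆ Metric.closedBall 0 R := by
    refine Metric.closedBall_subset_closedBall' ?_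
    simp [abs_of_nonneg hρ0]
  have h1 := hmean ρ (R - ρ) hs hsub
  have hpi := Real.two_pi_pos
  have hcirc : ∀ θ, ‖circleMap (ρ : ℂ) (R - ρ) θ‖ ≤ R := fun θ => by
    simpa using hsub (circleMap_mem_closedBall _ hs.le θ)
  -- For 0 < θ < π/2 the real part ρ + (R - ρ) cos θ exceeds ρ. Such points have modulus larger than
  -- that of any minimum point, so m is strictly above its minimum on an arc of positive length.
  have h2 : ∫⁻ θ in Ioc 0 (2 * Real.pi), m z₀
      < ∫⁻ θ in Ioc 0 (2 * Real.pi), m (circleMap (ρ : ℂ) (R - ρ) θ) := by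
    refine lintegral_strict_mono_of_ae_le_of_ae_lt_on (s := Ioo 0 (Real.pi / 2))
      (hm.comp (continuous_circleMap _ _).measurable).aemeasurable ?_
      (ae_of_all _ fun θ => hmin' _ (hcirc θ)) ?_ (ae_of_all _ fun θ hθ => ?_)
    · rw [lintegral_const]
      finiteness
    · rw [Measure.restrict_apply measurableSet_Ioo, inter_eq_left.2]
      · simp [Real.pi_pos]
      · intro θ hθ
        exact ⟨hθ.1, by linarith [hθ.2, Real.pi_pos]⟩
    · by_contra hle
      have h3 : ‖circleMap (ρ : ℂ) (R - ρ) θ‖ ≤ ρ :=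
        hmax ⟨by simpa using hcirc θ, not_lt.1 hle⟩
      have h4 := (Complex.re_le_norm _).trans h3
      rw [circleMap, Complex.exp_mul_I] at h4
      simp [← Complex.ofReal_cos, ← Complex.ofReal_sin] at h4
      have hcos := Real.cos_pos_of_mem_Ioo (x := θ) ⟨by linarith [hθ.1, Real.pi_pos], hθ.2⟩
      nlinarith [mul_pos hs hcos]
  rw [← hrad] at h1
  have h3 : ∫⁻ θ in Ioc 0 (2 * Real.pi), m z₀ = ENNReal.ofReal (2 * Real.pi) * m z₀ := by
    rw [lintegral_const, Measure.restrict_apply_univ, Real.volume_Ioc, sub_zero, mul_comm]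
  rw [h3] at h2
  have h4 : ENNReal.ofReal (2 * Real.pi) * ENNReal.ofReal (2 * Real.pi)⁻¹ = 1 := by
    rw [← ENNReal.ofReal_mul hpi.le, mul_inv_cancel₀ hpi.ne', ENNReal.ofReal_one]
  have h5 := mul_le_mul_right (h1.trans hz₁m') (ENNReal.ofReal (2 * Real.pi))
  rw [← mul_assoc, h4, one_mul] at h5
  exact h2.not_ge h5

/-! ### Monotonicity of the averages in the radius -/

section

variable {u : ℍ[ℝ] → EReal} {Ω : Set ℍ[ℝ]}

theorem complexLine_mem_closedBall {I : ℍ[ℝ]} (hI : I ∈ imaginaryUnits) {q p : ℍ[ℝ]} {z : ℂ}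
    {R : ℝ} (hp : ‖p‖ < 1) (hz : ‖z‖ ≤ R) : complexLine I q p z ∈ Metric.closedBall q R := by
  rw [complexLine_eq hI, mem_closedBall_iff_norm, add_sub_cancel_left, norm_mul,
    norm_complexEmbedding]
  nlinarith [norm_nonneg z, norm_nonneg p]

theorem complexLine_ofReal (I a b : ℍ[ℝ]) (t : ℝ) : complexLine I a b t = a + t • b := by
  simp [complexLine, Quaternion.coe_mul_eq_smul]

theorem measurable_lintegral_deficit_complexLine (hΩ : IsOpen Ω) (hu : IsUSCOn u Ω) (M : ℝ)
    (I q : ℍ[ℝ]) :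
    Measurable fun z => ∫⁻ p, deficit u Ω M (complexLine I q p z) ∂kernelMeasure := by
  have hcont : Continuous fun x : ℂ × ℍ[ℝ] => complexLine I q x.2 x.1 :=
    (continuous_complexLine I).comp
      (continuous_const.prodMk (continuous_snd.prodMk continuous_fst))
  exact ((measurable_deficit hΩ hu M).comp hcont.measurable).lintegral_prod_right'

/-- Write z = |z|c with |c| = 1. The factor c acts on p as left multiplication by a unit quaternion,
which does not change integrals against `kernelMeasure`. -/
theorem lintegral_deficit_complexLine_radial {I : ℍ[ℝ]} (hI : I ∈ imaginaryUnits) (M : ℝ)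
    (q : ℍ[ℝ]) (z : ℂ) :
    ∫⁻ p, deficit u Ω M (complexLine I q p z) ∂kernelMeasure
      = ∫⁻ p, deficit u Ω M (complexLine I q p (‖z‖ : ℝ)) ∂kernelMeasure := by
  obtain ⟨c, hc, hzc⟩ : ∃ c : ℂ, ‖c‖ = 1 ∧ z = (‖z‖ : ℝ) * c := by
    refine ⟨Complex.exp (z.arg * Complex.I), Complex.norm_exp_ofReal_mul_I _, ?_⟩
    exact (Complex.norm_mul_exp_arg_mul_I z).symm
  rw [← lintegral_kernelMeasure_comp_unit_mul (c := complexEmbedding hI c)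
    (by rw [norm_complexEmbedding, hc]) fun p => deficit u Ω M (complexLine I q p (‖z‖ : ℝ))]
  refine lintegral_congr fun p => ?_
  conv_lhs => rw [hzc]
  rw [complexLine_eq hI, complexLine_eq hI, map_mul, mul_assoc]

/-- Fatou's lemma along a sequence on which lower semicontinuity would fail. For almost every p the
limit point q + zp lies in `Ω`, where `deficit` is itself lower semicontinuous. -/
theorem lowerSemicontinuousOn_lintegral_deficit (hΩ : IsOpen Ω) (hu : IsUSCOn u Ω) (M : ℝ)
    {I : ℍ[ℝ]} (hI : I ∈ imaginaryUnits) {q : ℍ[ℝ]} {R : ℝ} (hq : Metric.closedBall q R ⊆ Ω) :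
    LowerSemicontinuousOn
      (fun z => ∫⁻ p, deficit u Ω M (complexLine I q p z) ∂kernelMeasure)
      (Metric.closedBall 0 R) := by
  intro z hz y hy
  by_contra hcon
  obtain ⟨s, hs, hsy⟩ := exists_seq_forall_of_frequently (not_eventually.1 hcon)
  have hs' : Tendsto s atTop (𝓝 z) := hs.mono_right nhdsWithin_le_nhds
  have hcont : ∀ p, Continuous fun x : ℂ => complexLine I q p x := fun p =>
    (continuous_complexLine I).comp
      (continuous_const.prodMk (continuous_const.prodMk continuous_id))
  have hcont' : ∀ x, Continuous fun p : ℍ[ℝ] => complexLine I q p x := fun x =>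
    (continuous_complexLine I).comp
      (continuous_const.prodMk (continuous_id.prodMk continuous_const))
  have h1 : ∫⁻ p, deficit u Ω M (complexLine I q p z) ∂kernelMeasure
      ≤ ∫⁻ p, liminf (fun n => deficit u Ω M (complexLine I q p (s n))) atTop ∂kernelMeasure := by
    refine lintegral_mono_ae ?_
    filter_upwards [ae_kernelMeasure_norm_lt_one] with p hp
    have hmem := hq (complexLine_mem_closedBall (q := q) hI hp (by simpa using hz))
    refine le_of_forall_lt fun c hc => ?_
    obtain ⟨d, hcd, hd⟩ := exists_between hc
    have := (((hcont p).tendsto z).comp hs').eventually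
      (lowerSemicontinuousAt_deficit hΩ hu M hmem d hd)
    exact hcd.trans_le (le_liminf_of_le (h := this.mono fun n hn => le_of_lt hn))
  have h2 := h1.trans (lintegral_liminf_le fun n =>
    (measurable_deficit hΩ hu M).comp (hcont' (s n)).measurable)
  have h3 : liminf (fun n => ∫⁻ p, deficit u Ω M (complexLine I q p (s n)) ∂kernelMeasure) atTop
      ≤ y :=
    liminf_le_of_le (h := fun b hb => by
      obtain ⟨n, hn⟩ := hb.exists
      exact hn.trans (not_lt.1 (hsy n)))
  exact (lt_of_lt_of_le hy (h2.trans h3)).false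

theorem lintegral_deficit_antitone (hΩ : IsOpen Ω) {I : ℍ[ℝ]} (hI : I ∈ imaginaryUnits)
    (hu : IsPlurisubharmonicOn I u Ω) {q : ℍ[ℝ]} {M r R : ℝ} (hr : 0 ≤ r) (hrR : r ≤ R)
    (hq : Metric.closedBall q R ⊆ Ω) (hM : ∀ p ∈ Metric.closedBall q R, u p ≤ M) :
    ∫⁻ p, deficit u Ω M (q + R • p) ∂kernelMeasure
      ≤ ∫⁻ p, deficit u Ω M (q + r • p) ∂kernelMeasure := by
  have := radial_le_of_superharmonic
    (measurable_lintegral_deficit_complexLine hΩ hu.1.1 M I q)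
    (lowerSemicontinuousOn_lintegral_deficit hΩ hu.1.1 M hI hq)
    (lintegral_deficit_complexLine_radial hI M q) (fun z s hs hzs => ?_) hr hrR
  · simpa only [complexLine_ofReal] using this
  · have hmem : ∀ p : ℍ[ℝ], ‖p‖ < 1 → ∀ x ∈ Metric.closedBall z s,
        complexLine I q p x ∈ Metric.closedBall q R := fun p hp x hx =>
      complexLine_mem_closedBall hI hp (by simpa using hzs hx)
    exact lintegral_circle_lintegral_deficit_le (α := fun _ => q) (β := fun p => p) hΩ hu
      continuous_const continuous_id hs
      (fun _ _ => hq (Metric.mem_closedBall_self (hr.trans hrR)))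
      (fun p hp x hx => hq (hmem p hp x hx)) fun p hp x hx => hM _ (hmem p hp x hx)

theorem lintegral_deficit_le (hΩ : IsOpen Ω) {I : ℍ[ℝ]} (hI : I ∈ imaginaryUnits)
    (hu : IsPlurisubharmonicOn I u Ω) {q : ℍ[ℝ]} {M R : ℝ} (hR : 0 ≤ R)
    (hq : Metric.closedBall q R ⊆ Ω) (hM : ∀ p ∈ Metric.closedBall q R, u p ≤ M) :
    ∫⁻ p, deficit u Ω M (q + R • p) ∂kernelMeasure ≤ deficit u Ω M q := by
  simpa using lintegral_deficit_antitone hΩ hI hu le_rfl hR hq hM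

end

/-! ### The scaled kernel and local integrability of u -/

theorem contDiff_scaledKernel (ε : ℝ) : ContDiff ℝ ∞ (scaledKernel ε) :=
  contDiff_const.mul (contDiff_standardKernel.comp (contDiff_const_smul ε⁻¹))

theorem scaledKernel_pos {ε : ℝ} {q : ℍ[ℝ]} (hq : ‖q‖ < ε) : 0 < scaledKernel ε q := by
  have hε : 0 < ε := (norm_nonneg q).trans_lt hq
  refine mul_pos (by positivity) (standardKernel_pos ?_)
  rw [norm_smul, norm_inv, Real.norm_of_nonneg hε.le]
  exact (inv_mul_lt_one₀ hε).2 hq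

theorem scaledKernel_eq_zero {ε : ℝ} (hε : 0 < ε) {q : ℍ[ℝ]} (hq : ε ≤ ‖q‖) :
    scaledKernel ε q = 0 := by
  rw [scaledKernel, standardKernel_eq_zero, mul_zero]
  rw [norm_smul, norm_inv, Real.norm_of_nonneg hε.le]
  exact (one_le_inv_mul₀ hε).2 hq

theorem hasCompactSupport_scaledKernel {ε : ℝ} (hε : 0 < ε) :
    HasCompactSupport (scaledKernel ε) :=
  HasCompactSupport.intro (isCompact_closedBall 0 ε) fun _ hq =>
    scaledKernel_eq_zero hε (not_le.1 (by simpa using hq)).le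

section

variable {u : ℍ[ℝ] → EReal} {Ω : Set ℍ[ℝ]}

theorem deficit_mono {M N : ℝ} (h : M ≤ N) (p : ℍ[ℝ]) : deficit u Ω M p ≤ deficit u Ω N p :=
  EReal.toENNReal_le_toENNReal (EReal.sub_le_sub (EReal.coe_le_coe_iff.2 h) le_rfl)

/-- Integrability over a set of finite volume therefore needs checking only for M = 0, a choice that
does not depend on the set. -/
theorem deficit_le_add (M : ℝ) (p : ℍ[ℝ]) :
    deficit u Ω M p ≤ ENNReal.ofReal M + deficit u Ω 0 p := by
  unfold deficit
  rw [sub_eq_add_neg, EReal.coe_zero, zero_sub, ← EReal.real_coe_toENNReal]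
  exact EReal.toENNReal_add_le

theorem deficit_ne_top {M : ℝ} {p : ℍ[ℝ]} (hp : p ∈ Ω) (h : u p ≠ ⊥) : deficit u Ω M p ≠ ⊤ := by
  rw [deficit, if_pos hp, EReal.toENNReal_ne_top_iff]
  generalize u p = x at *
  induction x with
  | bot => simp at h
  | top => simp
  | coe x => rw [← EReal.coe_sub]; exact EReal.coe_ne_top _

theorem deficit_eq_top {M : ℝ} {p : ℍ[ℝ]} (h : u p = ⊥) : deficit u Ω M p = ⊤ := by
  simp [deficit, h]

/-- The average of M - u against χ_R about q is at most M - u(q), which is finite, and χ_R has a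
positive lower bound on the ball of half the radius. -/
theorem setLIntegral_deficit_ball_lt_top (hΩ : IsOpen Ω) {I : ℍ[ℝ]} (hI : I ∈ imaginaryUnits)
    (hu : IsPlurisubharmonicOn I u Ω) {q : ℍ[ℝ]} {R : ℝ} (hR : 0 < R)
    (hq : Metric.closedBall q R ⊆ Ω) (huq : u q ≠ ⊥) :
    ∫⁻ p in Metric.ball q (R / 2), deficit u Ω 0 p < ⊤ := by
  obtain ⟨M, hM0, hM⟩ := exists_real_upper_bound hu.1.1 (isCompact_closedBall q R) hq
  have h1 := lintegral_deficit_le hΩ hI hu hR.le hq hM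
  rw [← lintegral_scaledKernel_mul hR] at h1
  obtain ⟨x, hx, hmin⟩ := (isCompact_closedBall (0 : ℍ[ℝ]) (R / 2)).exists_isMinOn
    ⟨0, by simpa using (half_pos hR).le⟩ (contDiff_scaledKernel R).continuous.continuousOn
  have hc : 0 < scaledKernel R x := by
    refine scaledKernel_pos ?_
    have : ‖x‖ ≤ R / 2 := by simpa using hx
    linarith
  have h2 : ENNReal.ofReal (scaledKernel R x) * ∫⁻ p in Metric.ball q (R / 2), deficit u Ω 0 p
      ≤ deficit u Ω M q := by
    refine le_trans ?_ h1
    rw [← lintegral_const_mul' _ _ ENNReal.ofReal_ne_top]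
    refine (setLIntegral_mono_ae' measurableSet_ball (ae_of_all _ fun p hp => ?_)).trans
      (setLIntegral_le_lintegral (Metric.ball q (R / 2)) _)
    refine mul_le_mul' (ENNReal.ofReal_le_ofReal (hmin ?_)) (deficit_mono hM0 p)
    rw [mem_closedBall_zero_iff, ← dist_eq_norm, dist_comm]
    exact (Metric.mem_ball.1 hp).le
  refine lt_top_iff_ne_top.2 fun htop => ?_
  rw [htop, ENNReal.mul_top (by simpa using hc)] at h2
  exact deficit_ne_top (hq (Metric.mem_closedBall_self hR.le)) huq (top_le_iff.1 h2)

/-- The points near which the negative part of u is integrable form an open set. It meets `Ω`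
because u is not identically -∞, and it is closed relative to `Ω`, so connectedness makes it contain
`Ω`. -/
theorem finiteAtFilter_withDensity_deficit (hΩ : IsOpen Ω) (hΩc : IsPreconnected Ω) {I : ℍ[ℝ]}
    (hI : I ∈ imaginaryUnits) (hu : IsPlurisubharmonicOn I u Ω) {q : ℍ[ℝ]} (hq : q ∈ Ω) :
    (volume.withDensity (deficit u Ω 0)).FiniteAtFilter (𝓝 q) := by
  set μ := volume.withDensity (deficit u Ω 0) with hμ
  have hball : ∀ p R, 0 < R → Metric.closedBall p R ⊆ Ω → u p ≠ ⊥ →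
      μ (Metric.ball p (R / 2)) < ⊤ := fun p R hR hp hup => by
    rw [hμ, withDensity_apply _ measurableSet_ball]
    exact setLIntegral_deficit_ball_lt_top hΩ hI hu hR hp hup
  have hsub : Ω ⊆ {q | μ.FiniteAtFilter (𝓝 q)} := by
    refine hΩc.subset_of_closure_inter_subset ?_ ?_ ?_
    · rw [isOpen_iff_mem_nhds]
      rintro a ⟨s, hs, hsμ⟩
      filter_upwards [eventually_mem_nhds_iff.2 hs] with b hb using ⟨s, hb, hsμ⟩
    · obtain ⟨p, hp, hup⟩ := hu.1.2 q hq
      have hpΩ := connectedComponentIn_subset Ω q hp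
      obtain ⟨R, hR, hRΩ⟩ := Metric.nhds_basis_closedBall.mem_iff.1 (hΩ.mem_nhds hpΩ)
      exact ⟨p, hpΩ, _, Metric.ball_mem_nhds p (half_pos hR), hball p R hR hRΩ hup⟩
    · rintro b ⟨hbA, hbΩ⟩
      obtain ⟨R, hR, hRΩ⟩ := Metric.nhds_basis_closedBall.mem_iff.1 (hΩ.mem_nhds hbΩ)
      -- A point p within R/6 of a is within R/3 of b. Hence the closed ball of radius 2R/3 about p
      -- stays in the ball of radius R about b, and its concentric ball of half the radius, R/3,
      -- still contains b.
      obtain ⟨a, ⟨s, hs, hsμ⟩, hab⟩ := Metric.mem_closure_iff.1 hbA (R / 6) (by positivity)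
      obtain ⟨ρ, hρ, hρs⟩ := Metric.mem_nhds_iff.1
        (inter_mem hs (Metric.ball_mem_nhds a (by positivity : 0 < R / 6)))
      -- If u were -∞ on the whole ball, a set of positive volume would carry infinite density,
      -- against finiteness near a.
      obtain ⟨p, hp, hup⟩ : ∃ p ∈ Metric.ball a ρ, u p ≠ ⊥ := by
        by_contra! hcon
        have h1 : μ (Metric.ball a ρ) = ⊤ := by
          rw [hμ, withDensity_apply _ measurableSet_ball,
            setLIntegral_congr_fun (g := fun _ => ⊤) measurableSet_ball
              fun p hp => deficit_eq_top (hcon p hp), setLIntegral_const,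
            ENNReal.top_mul (Metric.measure_ball_pos volume a hρ).ne']
        exact (measure_mono (hρs.trans inter_subset_left)).not_gt (h1 ▸ hsμ)
      have hpa : dist p a < R / 6 := (hρs hp).2
      refine ⟨_, Metric.isOpen_ball.mem_nhds ?_, hball p (2 * R / 3) (by positivity) ?_ hup⟩
      · have := dist_triangle b a p
        rw [dist_comm a p] at this
        rw [Metric.mem_ball]
        linarith
      · refine (Metric.closedBall_subset_closedBall' ?_).trans hRΩ
        have := dist_triangle p a b
        rw [dist_comm a b] at this
        linarith
  exact hsub hq

theorem setLIntegral_deficit_lt_top (hΩ : IsOpen Ω) (hΩc : IsPreconnected Ω) {I : ℍ[ℝ]}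
    (hI : I ∈ imaginaryUnits) (hu : IsPlurisubharmonicOn I u Ω) {K : Set ℍ[ℝ]}
    (hK : IsCompact K) (hKΩ : K ⊆ Ω) (M : ℝ) : ∫⁻ p in K, deficit u Ω M p < ⊤ := by
  have h1 : volume.withDensity (deficit u Ω 0) K < ⊤ :=
    hK.measure_lt_top_of_nhdsWithin fun x hx =>
      (finiteAtFilter_withDensity_deficit hΩ hΩc hI hu (hKΩ hx)).filter_mono nhdsWithin_le_nhds
  rw [withDensity_apply _ hK.measurableSet] at h1
  refine (lintegral_mono fun p => deficit_le_add M p).trans_lt ?_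
  rw [lintegral_add_left measurable_const, setLIntegral_const]
  exact ENNReal.add_lt_top.2 ⟨ENNReal.mul_lt_top ENNReal.ofReal_lt_top hK.measure_lt_top, h1⟩

/-! ### Smoothness of the mollification -/

theorem exists_contDiff_eq_mollify (hΩ : IsOpen Ω) (hΩc : IsPreconnected Ω) {I : ℍ[ℝ]}
    (hI : I ∈ imaginaryUnits) (hu : IsPlurisubharmonicOn I u Ω) {ε δ : ℝ} (hε : 0 < ε)
    {q₀ : ℍ[ℝ]} (hq₀ : Metric.closedBall q₀ (ε + δ) ⊆ Ω) :
    ∃ g : ℍ[ℝ] → ℝ, ContDiff ℝ ∞ g ∧ ∀ q ∈ Metric.ball q₀ δ, mollify u ε q = (g q : EReal) := by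
  set K := Metric.closedBall q₀ (ε + δ) with hKdef
  have hK : IsCompact K := isCompact_closedBall _ _
  obtain ⟨M, -, hM⟩ := exists_real_upper_bound hu.1.1 hK hq₀
  have hmeas := measurable_deficit hΩ hu.1.1 M
  have hfin := setLIntegral_deficit_lt_top hΩ hΩc hI hu hK hq₀ M
  -- Passing to real values alters `deficit` on K only on a null set, and the cutoff to K is
  -- invisible because χ_ε(q - ·) vanishes outside K for q in the ball of radius δ. What remains is
  -- an ordinary convolution of an integrable function with a test function.
  set G : ℍ[ℝ] → ℝ := K.indicator fun p => (deficit u Ω M p).toReal with hG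
  have hGint : Integrable G := by
    rw [hG, integrable_indicator_iff hK.measurableSet]
    exact integrable_toReal_of_lintegral_ne_top hmeas.aemeasurable hfin.ne
  have hG0 : ∀ p, 0 ≤ G p := fun p => indicator_nonneg (fun _ _ => ENNReal.toReal_nonneg) p
  refine ⟨fun q => M - convolution G (scaledKernel ε) (ContinuousLinearMap.lsmul ℝ ℝ) volume q,
    contDiff_const.sub ((hasCompactSupport_scaledKernel hε).contDiff_convolution_right _
      hGint.locallyIntegrable (contDiff_scaledKernel ε)), fun q hq => ?_⟩
  have hqK : Metric.closedBall q ε ⊆ K := Metric.closedBall_subset_closedBall' (by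
    have := Metric.mem_ball.1 hq
    linarith)
  have hint : Integrable fun t => G t * scaledKernel ε (q - t) := by
    have := ((hasCompactSupport_scaledKernel hε).convolutionExists_right
      (ContinuousLinearMap.lsmul ℝ ℝ) hGint.locallyIntegrable
      (contDiff_scaledKernel ε).continuous q : _)
    exact this
  rw [mollify_eq_coe_sub hΩ hu.1.1 hε (hqK.trans hq₀) fun p hp => hM p (hqK hp),
    ← lintegral_scaledKernel_mul hε]
  have h1 : ∫⁻ t, ENNReal.ofReal (scaledKernel ε (q - t)) * deficit u Ω M t
      = ENNReal.ofReal (∫ t, G t * scaledKernel ε (q - t)) := by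
    rw [ofReal_integral_eq_lintegral_ofReal hint
      (ae_of_all _ fun t => mul_nonneg (hG0 t) (scaledKernel_nonneg hε _))]
    refine lintegral_congr_ae ?_
    filter_upwards [(ae_restrict_iff' hK.measurableSet).1 (ae_lt_top hmeas hfin.ne)] with t ht
    rw [ENNReal.ofReal_mul (hG0 t), mul_comm]
    by_cases htK : t ∈ K
    · rw [hG, indicator_of_mem htK, ENNReal.ofReal_toReal (ht htK).ne]
    · rw [scaledKernel_eq_zero hε, ENNReal.ofReal_zero, mul_zero, mul_zero]
      rw [← dist_eq_norm, dist_comm]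
      exact (not_le.1 fun h => htK (hqK h)).le
  have h2 : 0 ≤ ∫ t, G t * scaledKernel ε (q - t) :=
    integral_nonneg fun t => mul_nonneg (hG0 t) (scaledKernel_nonneg hε _)
  rw [h1, EReal.coe_ennreal_ofReal, max_eq_left h2, ← EReal.coe_sub]
  rfl

/-- A ball about q is connected, so it could leave `Ω` only by meeting the frontier. Taking half of
the slack as δ keeps the radius below the distance to the frontier. -/
theorem exists_closedBall_subset_of_mem_innerDomain (hΩ : IsOpen Ω) {ε : ℝ} (hε : 0 < ε)
    {q : ℍ[ℝ]} (hq : q ∈ innerDomain Ω ε) : ∃ δ > 0, Metric.closedBall q (ε + δ) ⊆ Ω := by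
  by_cases hΩu : Ω = univ
  · exact ⟨1, one_pos, by simp [hΩu]⟩
  have hd := hq.2 hΩu
  refine ⟨(Metric.infDist q (frontier Ω) - ε) / 2, by linarith, ?_⟩
  refine (convex_closedBall q _).isPreconnected.subset_of_closure_inter_subset hΩ
    ⟨q, Metric.mem_closedBall_self (by linarith), hq.1⟩ ?_
  rintro x ⟨hx, hxb⟩
  by_contra hxΩ
  have h1 : x ∈ frontier Ω := by
    rw [hΩ.frontier_eq]
    exact ⟨hx, hxΩ⟩
  have h2 := Metric.infDist_le_dist_of_mem (x := q) h1
  rw [Metric.mem_closedBall, dist_comm] at hxb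
  linarith

theorem closedBall_subset_of_mem_innerDomain (hΩ : IsOpen Ω) {ε : ℝ} (hε : 0 < ε)
    {q : ℍ[ℝ]} (hq : q ∈ innerDomain Ω ε) : Metric.closedBall q ε ⊆ Ω := by
  obtain ⟨δ, hδ, h⟩ := exists_closedBall_subset_of_mem_innerDomain hΩ hε hq
  exact (Metric.closedBall_subset_closedBall (by linarith)).trans h

theorem contDiffOn_mollify (hΩ : IsOpen Ω) (hΩc : IsPreconnected Ω) {I : ℍ[ℝ]}
    (hI : I ∈ imaginaryUnits) (hu : IsPlurisubharmonicOn I u Ω) {ε : ℝ} (hε : 0 < ε) :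
    ∃ v : ℍ[ℝ] → ℝ, ContDiffOn ℝ ∞ v (innerDomain Ω ε) ∧
      ∀ q ∈ innerDomain Ω ε, mollify u ε q = (v q : EReal) := by
  refine ⟨fun q => (mollify u ε q).toReal, fun q hq => ?_, fun q hq => ?_⟩ <;>
    obtain ⟨δ, hδ, hδΩ⟩ := exists_closedBall_subset_of_mem_innerDomain hΩ hε hq <;>
    obtain ⟨g, hg, hgeq⟩ := exists_contDiff_eq_mollify hΩ hΩc hI hu hε hδΩ
  · refine (hg.contDiffAt.congr_of_eventuallyEq ?_).contDiffWithinAt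
    filter_upwards [Metric.ball_mem_nhds q hδ] with p hp
    rw [hgeq p hp, EReal.toReal_coe]
  · simp only [hgeq q (Metric.mem_ball_self hδ), EReal.toReal_coe]

theorem isUSCOn_of_eq_coe {X : Type*} [TopologicalSpace X] {v : X → ℝ} {f : X → EReal} {U : Set X}
    (hv : ContinuousOn v U) (hf : ∀ x ∈ U, f x = (v x : EReal)) : IsUSCOn f U :=
  ⟨((continuous_coe_real_ereal.comp_continuousOn hv).congr hf).upperSemicontinuousOn,
    fun x hx => (hf x hx).symm ▸ EReal.coe_lt_top _⟩

/-! ### Plurisubharmonicity of the mollification -/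

open scoped Pointwise in
-- The mollification averages the translates of u by εp. Each satisfies the sub-mean value
-- inequality on the parallel line through a + εp, and Tonelli averages these inequalities over p.
theorem isPlurisubharmonicOn_mollify (hΩ : IsOpen Ω) (hΩc : IsPreconnected Ω) {I : ℍ[ℝ]}
    (hI : I ∈ imaginaryUnits) (hu : IsPlurisubharmonicOn I u Ω) {ε : ℝ} (hε : 0 < ε) :
    IsPlurisubharmonicOn I (mollify u ε) (innerDomain Ω ε) := by
  obtain ⟨v, hv, hveq⟩ := contDiffOn_mollify hΩ hΩc hI hu hε
  refine ⟨⟨isUSCOn_of_eq_coe hv.continuousOn hveq, fun q hq =>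
    ⟨q, mem_connectedComponentIn hq, by rw [hveq q hq]; exact EReal.coe_ne_bot _⟩⟩,
    fun a ha b => ?_⟩
  have hline : Continuous (complexLine I a b) :=
    (continuous_complexLine I).comp
      (continuous_const.prodMk (continuous_const.prodMk continuous_id))
  refine ⟨isUSCOn_of_eq_coe (v := fun z => v (complexLine I a b z))
    (hv.continuousOn.comp hline.continuousOn fun _ hz => hz) fun z hz => hveq _ hz,
    fun z r hr hzr => ?_⟩
  have hball := fun q hq => closedBall_subset_of_mem_innerDomain hΩ hε (q := q) hq
  -- The closed ε-neighbourhood of the image of the disc is compact, so a single M serves all the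
  -- translated discs.
  have hK : IsCompact (complexLine I a b '' Metric.closedBall z r + Metric.closedBall (0 : ℍ[ℝ]) ε) :=
    ((isCompact_closedBall z r).image hline).add (isCompact_closedBall 0 ε)
  have hsub : ∀ x ∈ Metric.closedBall z r, Metric.closedBall (complexLine I a b x) ε
      ⊆ complexLine I a b '' Metric.closedBall z r + Metric.closedBall (0 : ℍ[ℝ]) ε := fun x hx y hy =>
    ⟨_, mem_image_of_mem _ hx, y - complexLine I a b x,
      by simpa [← dist_eq_norm] using hy, add_sub_cancel _ _⟩
  have hKΩ : complexLine I a b '' Metric.closedBall z r + Metric.closedBall (0 : ℍ[ℝ]) ε ⊆ Ω := by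
    rintro _ ⟨_, ⟨x, hx, rfl⟩, y, hy, rfl⟩
    exact hball _ (hzr hx) (by simpa using hy)
  obtain ⟨M, -, hM⟩ := exists_real_upper_bound hu.1.1 hK hKΩ
  have hmol : ∀ x ∈ Metric.closedBall z r, mollify u ε (complexLine I a b x) = (M : EReal)
      - ((∫⁻ p, deficit u Ω M (complexLine I (a + ε • p) b x) ∂kernelMeasure : ENNReal) : EReal) :=
    fun x hx => by
      rw [mollify_eq_coe_sub hΩ hu.1.1 hε ((hsub x hx).trans hKΩ) fun p hp => hM p (hsub x hx hp)]
      simp only [complexLine, add_right_comm]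
  have hmem : ∀ p : ℍ[ℝ], ‖p‖ < 1 → ∀ x, complexLine I (a + ε • p) b x ∈
      Metric.closedBall (complexLine I a b x) ε := fun p hp x => by
    have : complexLine I (a + ε • p) b x - complexLine I a b x = ε • p := by
      simp only [complexLine]; abel
    rw [mem_closedBall_iff_norm, this, norm_smul, Real.norm_of_nonneg hε.le]
    nlinarith
  have hcont : Continuous fun x : ℝ × ℍ[ℝ] =>
      complexLine I (a + ε • x.2) b (circleMap z r x.1) :=
    (continuous_complexLine I).comp ((by fun_prop : Continuous fun x : ℝ × ℍ[ℝ] =>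
      a + ε • x.2).prodMk (continuous_const.prodMk
        ((continuous_circleMap z r).comp continuous_fst)))
  change mollify u ε (complexLine I a b z) ≤ _
  rw [circleMean_coe_sub M (w := fun θ =>
      ∫⁻ p, deficit u Ω M (complexLine I (a + ε • p) b (circleMap z r θ)) ∂kernelMeasure)
      ((measurable_deficit hΩ hu.1.1 M).comp hcont.measurable).lintegral_prod_right'
      fun θ => hmol _ (circleMap_mem_closedBall z hr.le θ),
    hmol z (Metric.mem_closedBall_self hr.le), coe_sub_coe_ennreal_le_iff]
  refine lintegral_circle_lintegral_deficit_le (α := fun p => a + ε • p) (β := fun _ => b) hΩ hu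
    (by fun_prop) continuous_const hr (fun p hp => hball a ha ?_)
    (fun p hp x hx => hKΩ (hsub x hx (hmem p hp x)))
    fun p hp x hx => hM _ (hsub x hx (hmem p hp x))
  rw [mem_closedBall_iff_norm, add_sub_cancel_left, norm_smul, Real.norm_of_nonneg hε.le]
  nlinarith

/-! ### Monotonicity in ε and the limit -/

theorem mollify_mono (hΩ : IsOpen Ω) {I : ℍ[ℝ]} (hI : I ∈ imaginaryUnits)
    (hu : IsPlurisubharmonicOn I u Ω) {ε₁ ε₂ : ℝ} (h₁ : 0 < ε₁) (h₂ : ε₁ ≤ ε₂) {q : ℍ[ℝ]}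
    (hq : Metric.closedBall q ε₂ ⊆ Ω) : mollify u ε₁ q ≤ mollify u ε₂ q := by
  obtain ⟨M, -, hM⟩ := exists_real_upper_bound hu.1.1 (isCompact_closedBall q ε₂) hq
  have hsub : Metric.closedBall q ε₁ ⊆ Metric.closedBall q ε₂ :=
    Metric.closedBall_subset_closedBall h₂
  rw [mollify_eq_coe_sub hΩ hu.1.1 h₁ (hsub.trans hq) fun p hp => hM p (hsub hp),
    mollify_eq_coe_sub hΩ hu.1.1 (h₁.trans_le h₂) hq hM, coe_sub_coe_ennreal_le_iff]
  exact lintegral_deficit_antitone hΩ hI hu h₁.le h₂ hq hM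

theorem le_mollify (hΩ : IsOpen Ω) {I : ℍ[ℝ]} (hI : I ∈ imaginaryUnits)
    (hu : IsPlurisubharmonicOn I u Ω) {ε : ℝ} (hε : 0 < ε) {q : ℍ[ℝ]}
    (hq : Metric.closedBall q ε ⊆ Ω) : u q ≤ mollify u ε q := by
  obtain ⟨M, -, hM⟩ := exists_real_upper_bound hu.1.1 (isCompact_closedBall q ε) hq
  have hqq : q ∈ Metric.closedBall q ε := Metric.mem_closedBall_self hε.le
  rw [mollify_eq_coe_sub hΩ hu.1.1 hε hq hM, ← coe_sub_deficit (hq hqq) (hM q hqq),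
    coe_sub_coe_ennreal_le_iff]
  exact lintegral_deficit_le hΩ hI hu hε.le hq hM

theorem mollify_le (hΩ : IsOpen Ω) (hu : IsUSCOn u Ω) {ε : ℝ} (hε : 0 < ε) {q : ℍ[ℝ]} {M : ℝ}
    (hq : Metric.closedBall q ε ⊆ Ω) (hM : ∀ p ∈ Metric.closedBall q ε, u p ≤ M) :
    mollify u ε q ≤ M := by
  rw [mollify_eq_coe_sub hΩ hu hε hq hM]
  simpa using (coe_sub_coe_ennreal_le_iff M _ 0).2 zero_le

/-- The lower bound is u ≤ u * χ_ε. For the upper bound, u < c on a small ball by upper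
semicontinuity, so the average is at most c; this covers u(q) = -∞ as well. -/
theorem tendsto_mollify (hΩ : IsOpen Ω) {I : ℍ[ℝ]} (hI : I ∈ imaginaryUnits)
    (hu : IsPlurisubharmonicOn I u Ω) {q : ℍ[ℝ]} (hq : q ∈ Ω) :
    Tendsto (fun ε : ℝ => mollify u ε q) (𝓝[>] 0) (𝓝 (u q)) := by
  have hsmall : ∀ s ∈ 𝓝 q, ∀ᶠ ε : ℝ in 𝓝[>] 0, 0 < ε ∧ Metric.closedBall q ε ⊆ s := by
    intro s hs
    obtain ⟨δ, hδ, hδs⟩ := Metric.nhds_basis_closedBall.mem_iff.1 hs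
    filter_upwards [Ioc_mem_nhdsGT hδ] with ε hε
    exact ⟨hε.1, (Metric.closedBall_subset_closedBall hε.2).trans hδs⟩
  refine tendsto_order.2 ⟨fun a ha => ?_, fun a ha => ?_⟩
  · filter_upwards [hsmall Ω (hΩ.mem_nhds hq)] with ε hε
    exact ha.trans_le (le_mollify hΩ hI hu hε.1 hε.2)
  · obtain ⟨c, hc, hca⟩ := EReal.lt_iff_exists_real_btwn.1 ha
    have h1 := hu.1.1.1 q hq c hc
    rw [hΩ.nhdsWithin_eq hq] at h1
    filter_upwards [hsmall _ (inter_mem (hΩ.mem_nhds hq) h1)] with ε hε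
    exact (mollify_le hΩ hu.1.1 hε.1 (fun p hp => (hε.2 hp).1)
      fun p hp => le_of_lt (hε.2 hp).2).trans_lt hca

end

theorem exists_mem_imaginaryUnits : ∃ I, I ∈ imaginaryUnits :=
  ⟨⟨0, 1, 0, 0⟩, by
    change (⟨0, 1, 0, 0⟩ : ℍ[ℝ]) * ⟨0, 1, 0, 0⟩ = -1
    ext <;> simp⟩

theorem mainTheorem9 (Ω : Set ℍ[ℝ]) (hΩ : IsOpen Ω) (hΩc : IsConnected Ω)
    (u : ℍ[ℝ] → EReal) (hu : IsStronglySubharmonicOn u Ω) :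
    (∀ ε : ℝ, 0 < ε → (innerDomain Ω ε).Nonempty →
      (∃ v : ℍ[ℝ] → ℝ, ContDiffOn ℝ ∞ v (innerDomain Ω ε) ∧
        ∀ q ∈ innerDomain Ω ε, mollify u ε q = (v q : EReal)) ∧
      IsStronglySubharmonicOn (mollify u ε) (innerDomain Ω ε)) ∧
    (∀ ε₁ ε₂ : ℝ, 0 < ε₁ → ε₁ ≤ ε₂ → ∀ q ∈ innerDomain Ω ε₂, mollify u ε₁ q ≤ mollify u ε₂ q) ∧
    (∀ q ∈ Ω, Tendsto (fun ε : ℝ => mollify u ε q) (𝓝[>] 0) (𝓝 (u q))) := by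
  -- Smoothness, monotonicity and the limit need only one complex structure; strong subharmonicity
  -- of the mollification is checked for each J separately.
  obtain ⟨I, hI⟩ := exists_mem_imaginaryUnits
  refine ⟨fun ε hε _ => ⟨contDiffOn_mollify hΩ hΩc.isPreconnected hI (hu I hI) hε, fun J hJ =>
    isPlurisubharmonicOn_mollify hΩ hΩc.isPreconnected hJ (hu J hJ) hε⟩, ?_, fun q hq =>
    tendsto_mollify hΩ hI (hu I hI) hq⟩
  exact fun ε₁ ε₂ h₁ h₂ q hq => mollify_mono hΩ hI (hu I hI) h₁ h₂
    (closedBall_subset_of_mem_innerDomain hΩ (h₁.trans_le h₂) hq)
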